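/- Let $a,b>0$ and $p_0(1),p_0(2)\ge 0$ with $p_0(1)+p_0(2)>0$, and let $$\rho = a+b-\big(\max(p_0(1),p_0(2))-\min(p_0(1),p_0(2))\big).$$ For $N\ge 1$ consider the Fleming--Viot system of $N$ particles on $\{1,2\}$: each particle jumps from $1$ to $2$ at rate $a$ and from $2$ to $1$ at rate $b$, and a particle at site $i$ is killed at rate $p_0(i)$ and then jumps immediately to the position of one of the other $N-1$ particles, chosen uniformly at random. The number $\eta_t(1)$ of particles at site $1$ is a birth--death process on $\{0,\dots,N\}$ with generator $$\mathcal{G}f(n)=b_n\,(f(n+1)-f(n))+d_n\,(f(n-1)-f(n)),$$ $$b_n=(N-n)\Big(b+p_0(2)\frac{n}{N-1}\Big),\qquad d_n=n\Big(a+p_0(1)\frac{N-n}{N-1}\Big),$$ where for $N=1$ the fractions with denominator $N-1$ are read as $0$. Let $\lambda_N$ denote its spectral gap, that is, the smallest positive eigenvalue of $-\mathcal{G}$ acting on functions $f:\{0,\dots,N\}\to\mathbb{R}$. If $\rho\le 0$, then there exists a constant $c>0$, which does not depend on $N$, such that $\lambda_N>c$ for every $N\ge 1$. -/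

import Mathlib

noncomputable section

namespace FlemingViotTwoPoint

/-- Birth rate `b_n` at `n` of the number of particles at site `1`, for `N` particles: each of the
`N - n` particles at site `2` jumps to site `1` at rate `b`, or is killed at rate `p₂` and then
sent to the position of one of the `N - 1` other particles chosen uniformly.
For `N = 1` the interaction term `(N - n) * n` vanishes, in agreement with `x / 0 = 0`. -/
def birthRate (b p₂ : ℝ) (N n : ℕ) : ℝ :=
  ((N : ℝ) - n) * (b + p₂ * (n / ((N : ℝ) - 1)))

/-- Death rate `d_n` at `n` of the number of particles at site `1`, for `N` particles. -/
def deathRate (a p₁ : ℝ) (N n : ℕ) : ℝ :=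
  (n : ℝ) * (a + p₁ * (((N : ℝ) - n) / ((N : ℝ) - 1)))

/-- The state `n + 1` of `{0, …, N}` (the value at `n = N` is irrelevant, since `b_N = 0`). -/
def up {N : ℕ} (n : Fin (N + 1)) : Fin (N + 1) :=
  ⟨min (n.val + 1) N, Nat.lt_succ_of_le (min_le_right _ _)⟩

/-- The state `n - 1` of `{0, …, N}` (the value at `n = 0` is irrelevant, since `d_0 = 0`). -/
def down {N : ℕ} (n : Fin (N + 1)) : Fin (N + 1) :=
  ⟨n.val - 1, lt_of_le_of_lt (Nat.sub_le _ _) n.isLt⟩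

/-- The generator of the birth-death process `η_t(1)` on `{0, …, N}`:
`f ↦ (n ↦ b_n (f (n + 1) - f n) + d_n (f (n - 1) - f n))`. -/
def generator (a b p₁ p₂ : ℝ) (N : ℕ) : Module.End ℝ (Fin (N + 1) → ℝ) where
  toFun f n := birthRate b p₂ N n.val * (f (up n) - f n)
    + deathRate a p₁ N n.val * (f (down n) - f n)
  map_add' f g := by
    funext n
    simp only [Pi.add_apply]
    ring
  map_smul' c f := by
    funext n
    simp only [Pi.smul_apply, smul_eq_mul, RingHom.id_apply]
    ring

/-- The spectral gap: the smallest positive eigenvalue of `-𝓖`. The set below is finite. If it were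
empty, the value would be `0`. -/
def spectralGap (a b p₁ p₂ : ℝ) (N : ℕ) : ℝ :=
  sInf {μ : ℝ | 0 < μ ∧ (-generator a b p₁ p₂ N).HasEigenvalue μ}

/-- The curvature-type constant `ρ = a + b - (sup p₀ - inf p₀)`. -/
def rho (a b p₁ p₂ : ℝ) : ℝ :=
  a + b - (max p₁ p₂ - min p₁ p₂)

end FlemingViotTwoPoint

end

/-!
The increments `g n = f (n + 1) - f n` of an eigenfunction `f` of `-𝓖` with eigenvalue `μ` satisfy
the closed system
`(d_{n+1} + b_n - μ) g n = b_{n+1} g (n + 1) + d_n g (n - 1)` for `0 ≤ n < N`.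
If `w` is a positive weight on `{0, …, N - 1}` with
`c w_n ≤ (d_{n+1} + b_n) w_n - b_{n+1} w_{n+1} - d_n w_{n-1}`, then reading the system at a point
where `|g| / w` is maximal gives `c ≤ μ` (`le_of_hasEigenvalue`). The weight `w = 1` produces the
constant `ρ`, which is useless when `ρ ≤ 0`. For `p₁ ≤ p₂` the weight `w_n = 1 / (n + 1)` has the
exact ratio
`(N + 1) / (n + 2) * (b - p₂ / (N - 1)) + (p₂ - p₁) * (n + 1) / (N - 1)`,
which is at least `b / 2` as soon as `N - 1 ≥ 2 p₂ / b`; for `p₂ ≤ p₁` the mirror image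
`w_n = 1 / (N - n)` works in the same way with `a` and `p₁`. This bounds the gap from below for all
large `N`.

It remains to see that the gap is positive for each single `N`. The matrix of `-𝓖` is conjugate by a
diagonal matrix to a real symmetric one, because the rates between neighbouring states are positive
(`detailed_balance`), and its trace is positive, so a positive eigenvalue exists
(`exists_pos_hasEigenvalue`). As there are only finitely many eigenvalues, the infimum that defines
the gap is attained. The finitely many small `N` then contribute a positive minimum.
-/

namespace FlemingViotTwoPoint

variable {a b p₁ p₂ : ℝ} {N n : ℕ}

/-! ### Elementary properties of the rates -/

lemma birthRate_nonneg (hb : 0 ≤ b) (hp₂ : 0 ≤ p₂) (hN : 1 ≤ N) (hn : n ≤ N) :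
    0 ≤ birthRate b p₂ N n := by
  have h1 : (1 : ℝ) ≤ N := by exact_mod_cast hN
  have h2 : (n : ℝ) ≤ N := by exact_mod_cast hn
  have h3 : (0 : ℝ) ≤ n / ((N : ℝ) - 1) := div_nonneg n.cast_nonneg (by linarith)
  exact mul_nonneg (by linarith) (by positivity)

lemma birthRate_pos (hb : 0 < b) (hp₂ : 0 ≤ p₂) (hN : 1 ≤ N) (hn : n < N) :
    0 < birthRate b p₂ N n := by
  have h1 : (1 : ℝ) ≤ N := by exact_mod_cast hN
  have h2 : (n : ℝ) < N := by exact_mod_cast hn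
  have h3 : (0 : ℝ) ≤ n / ((N : ℝ) - 1) := div_nonneg n.cast_nonneg (by linarith)
  exact mul_pos (by linarith) (by positivity)

lemma deathRate_nonneg (ha : 0 ≤ a) (hp₁ : 0 ≤ p₁) (hN : 1 ≤ N) (hn : n ≤ N) :
    0 ≤ deathRate a p₁ N n := by
  have h1 : (1 : ℝ) ≤ N := by exact_mod_cast hN
  have h2 : (n : ℝ) ≤ N := by exact_mod_cast hn
  have h3 : (0 : ℝ) ≤ ((N : ℝ) - n) / ((N : ℝ) - 1) := div_nonneg (by linarith) (by linarith)
  exact mul_nonneg n.cast_nonneg (by positivity)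

lemma deathRate_pos (ha : 0 < a) (hp₁ : 0 ≤ p₁) (hN : 1 ≤ N) (h0 : 0 < n) (hn : n ≤ N) :
    0 < deathRate a p₁ N n := by
  have h1 : (1 : ℝ) ≤ N := by exact_mod_cast hN
  have h2 : (n : ℝ) ≤ N := by exact_mod_cast hn
  have h3 : (0 : ℝ) ≤ ((N : ℝ) - n) / ((N : ℝ) - 1) := div_nonneg (by linarith) (by linarith)
  exact mul_pos (by exact_mod_cast h0) (by positivity)

@[simp] lemma birthRate_self : birthRate b p₂ N N = 0 := by simp [birthRate]

@[simp] lemma deathRate_zero : deathRate a p₁ N 0 = 0 := by simp [deathRate]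

/-! ### Eigenvalue bounds from weights on the increments -/

/-- A positive supersolution `w` of the equation for increments bounds every positive eigenvalue of
`-𝓖` from below. The value `w N` is irrelevant because `b_N = 0`. -/
lemma le_of_hasEigenvalue (ha : 0 ≤ a) (hb : 0 ≤ b) (hp₁ : 0 ≤ p₁) (hp₂ : 0 ≤ p₂) (hN : 1 ≤ N)
    {w : ℕ → ℝ} {c μ : ℝ} (hw : ∀ n < N, 0 < w n)
    (hc : ∀ n < N, c * w n ≤ (deathRate a p₁ N (n + 1) + birthRate b p₂ N n) * w n
      - birthRate b p₂ N (n + 1) * w (n + 1) - deathRate a p₁ N n * w (n - 1))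
    (hμ0 : 0 < μ) (hμ : (-generator a b p₁ p₂ N).HasEigenvalue μ) : c ≤ μ := by
  obtain ⟨f, hf⟩ := hμ.exists_hasEigenvector
  have hfe : ∀ i, -generator a b p₁ p₂ N f i = μ * f i := fun i ↦ congrFun hf.apply_eq_smul i
  have hf0 : f ≠ 0 := hf.2
  set F : ℕ → ℝ := fun k ↦ f ⟨min k N, by omega⟩ with hF
  have hFe : ∀ n ≤ N, -(birthRate b p₂ N n * (F (n + 1) - F n)
      + deathRate a p₁ N n * (F (n - 1) - F n)) = μ * F n := by
    intro n hn
    have h := hfe ⟨n, by omega⟩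
    have h1 : F n = f ⟨n, by omega⟩ := by simp [hF, hn]
    have h2 : F (n + 1) = f (up ⟨n, by omega⟩) := rfl
    have h3 : F (n - 1) = f (down ⟨n, by omega⟩) := by
      simp only [hF, down]
      congr 2
      omega
    rw [h1, h2, h3]
    exact h
  obtain ⟨m, hm, hmax⟩ := (Finset.range N).exists_max_image (fun k ↦ |F (k + 1) - F k| / w k)
    ⟨0, by simp; omega⟩
  have hmN : m < N := by simpa using hm
  set M := |F (m + 1) - F m| / w m with hM
  have hMle : ∀ k < N, |F (k + 1) - F k| ≤ M * w k := fun k hk ↦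
    (div_le_iff₀ (hw k hk)).1 (hmax k (by simpa using hk))
  have hMm : |F (m + 1) - F m| = M * w m := by
    rw [hM, div_mul_cancel₀ _ (hw m hmN).ne']
  have hM0 : 0 < M := by
    by_contra hle
    have hz : ∀ k < N, F (k + 1) = F k := fun k hk ↦ by
      have := (hMle k hk).trans (mul_nonpos_of_nonpos_of_nonneg (not_lt.1 hle) (hw k hk).le)
      exact sub_eq_zero.1 (abs_nonpos_iff.1 this)
    have hconst : ∀ k ≤ N, F k = F 0 := by
      intro k
      induction k with
      | zero => simp
      | succ k ih => intro hk; rw [hz k hk, ih (by omega)]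
    have h0 : F 0 = 0 := by
      have h := hFe 0 (by omega)
      rw [hz 0 (by omega)] at h
      simp at h
      exact h.resolve_left hμ0.ne'
    apply hf0
    funext i
    have h := hconst i (by omega)
    rw [h0] at h
    simpa [hF, Nat.lt_succ_iff.1 i.isLt] using h
  have hb0 := birthRate_nonneg hb hp₂ hN (show m + 1 ≤ N by omega)
  have hd0 := deathRate_nonneg ha hp₁ hN hmN.le
  have hup : birthRate b p₂ N (m + 1) * |F (m + 2) - F (m + 1)|
      ≤ birthRate b p₂ N (m + 1) * (M * w (m + 1)) := by
    rcases Nat.lt_or_ge (m + 1) N with h | h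
    · exact mul_le_mul_of_nonneg_left (hMle _ h) hb0
    · simp [show m + 1 = N by omega]
  have hdown : deathRate a p₁ N m * |F m - F (m - 1)|
      ≤ deathRate a p₁ N m * (M * w (m - 1)) := by
    rcases Nat.eq_zero_or_pos m with rfl | h
    · simp
    · have := hMle (m - 1) (by omega)
      rw [show m - 1 + 1 = m by omega] at this
      exact mul_le_mul_of_nonneg_left this hd0
  have e1 := hFe m hmN.le
  have e2 := hFe (m + 1) (by omega)
  rw [show m + 1 - 1 = m by omega] at e2
  have key : (deathRate a p₁ N (m + 1) + birthRate b p₂ N m - μ) * (F (m + 1) - F m)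
      = birthRate b p₂ N (m + 1) * (F (m + 2) - F (m + 1))
        + deathRate a p₁ N m * (F m - F (m - 1)) := by
    linear_combination e2 - e1
  have habs : (deathRate a p₁ N (m + 1) + birthRate b p₂ N m - μ) * (M * w m)
      ≤ birthRate b p₂ N (m + 1) * (M * w (m + 1)) + deathRate a p₁ N m * (M * w (m - 1)) := by
    calc _ ≤ |deathRate a p₁ N (m + 1) + birthRate b p₂ N m - μ| * |F (m + 1) - F m| := by
          rw [hMm]
          exact mul_le_mul_of_nonneg_right (le_abs_self _) (mul_pos hM0 (hw m hmN)).le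
      _ = |birthRate b p₂ N (m + 1) * (F (m + 2) - F (m + 1))
            + deathRate a p₁ N m * (F m - F (m - 1))| := by rw [← abs_mul, key]
      _ ≤ _ := (abs_add_le _ _).trans (by
          rw [abs_mul, abs_mul, abs_of_nonneg hb0, abs_of_nonneg hd0]
          exact add_le_add hup hdown)
  have hcm := mul_le_mul_of_nonneg_left (hc m hmN) hM0.le
  refine le_of_mul_le_mul_right ?_ (mul_pos hM0 (hw m hmN))
  linarith

/-- The bound from the weight `w n = 1 / (n + 1)`. -/
lemma half_le_of_hasEigenvalue_of_le (ha : 0 ≤ a) (hb : 0 ≤ b) (hp₁ : 0 ≤ p₁) (hp₂ : 0 ≤ p₂)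
    (h12 : p₁ ≤ p₂) (hN : 2 ≤ N) (hbig : 2 * p₂ ≤ b * ((N : ℝ) - 1)) {μ : ℝ} (hμ0 : 0 < μ)
    (hμ : (-generator a b p₁ p₂ N).HasEigenvalue μ) : b / 2 ≤ μ := by
  refine le_of_hasEigenvalue ha hb hp₁ hp₂ (by omega) (w := fun n ↦ 1 / ((n : ℝ) + 1))
    (fun n _ ↦ by positivity) (fun n hn ↦ ?_) hμ0 hμ
  have hN' : (0 : ℝ) < (N : ℝ) - 1 := by
    have : (2 : ℝ) ≤ N := by exact_mod_cast hN
    linarith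
  have hn' : (n : ℝ) + 1 ≤ N := by exact_mod_cast hn
  have hpN : p₂ / ((N : ℝ) - 1) ≤ b / 2 := by rw [div_le_iff₀ hN']; linarith
  have hN0 := hN'.ne'
  -- equality, except for `n = 0`, where the left side vanishes
  have hdown : deathRate a p₁ N n * (1 / (((n - 1 : ℕ) : ℝ) + 1))
      ≤ a + p₁ * (((N : ℝ) - n) / ((N : ℝ) - 1)) := by
    rcases Nat.eq_zero_or_pos n with rfl | h
    · have : 0 ≤ ((N : ℝ) - (0 : ℕ)) / ((N : ℝ) - 1) := div_nonneg (by simp) hN'.le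
      rw [deathRate_zero, zero_mul]
      positivity
    · have h1 : (((n - 1 : ℕ) : ℝ) + 1) = n := by
        rw [Nat.cast_sub h]; simp
      have h0 : (n : ℝ) ≠ 0 := by exact_mod_cast h.ne'
      rw [h1, deathRate]
      exact le_of_eq (by field_simp)
  have hid : (deathRate a p₁ N (n + 1) + birthRate b p₂ N n) * (1 / ((n : ℝ) + 1))
      - birthRate b p₂ N (n + 1) * (1 / (((n + 1 : ℕ) : ℝ) + 1))
      - (a + p₁ * (((N : ℝ) - n) / ((N : ℝ) - 1)))
      = (((N : ℝ) + 1) / (n + 2) * (b - p₂ / ((N : ℝ) - 1))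
        + (p₂ - p₁) * ((n + 1) / ((N : ℝ) - 1))) * (1 / ((n : ℝ) + 1)) := by
    have h1 : (n : ℝ) + 1 ≠ 0 := by positivity
    have h2 : (n : ℝ) + 2 ≠ 0 := by positivity
    have h3 : (n : ℝ) + 1 + 1 ≠ 0 := by positivity
    simp only [deathRate, birthRate, Nat.cast_add, Nat.cast_one]
    field_simp
    ring
  have hfac : b / 2 ≤ ((N : ℝ) + 1) / (n + 2) * (b - p₂ / ((N : ℝ) - 1))
        + (p₂ - p₁) * ((n + 1) / ((N : ℝ) - 1)) := by
    have h1 : 1 ≤ ((N : ℝ) + 1) / (n + 2) := by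
      rw [le_div_iff₀ (by positivity)]; linarith
    have h2 : 0 ≤ (p₂ - p₁) * (((n : ℝ) + 1) / ((N : ℝ) - 1)) :=
      mul_nonneg (by linarith) (by positivity)
    have h3 := mul_le_mul_of_nonneg_right h1 (show 0 ≤ b - p₂ / ((N : ℝ) - 1) by linarith)
    linarith
  have := mul_le_mul_of_nonneg_right hfac (show 0 ≤ 1 / ((n : ℝ) + 1) by positivity)
  linarith

/-- The bound from the mirror image `w n = 1 / (N - n)` of the weight `1 / (n + 1)`. -/
lemma half_le_of_hasEigenvalue_of_ge (ha : 0 ≤ a) (hb : 0 ≤ b) (hp₁ : 0 ≤ p₁) (hp₂ : 0 ≤ p₂)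
    (h21 : p₂ ≤ p₁) (hN : 2 ≤ N) (hbig : 2 * p₁ ≤ a * ((N : ℝ) - 1)) {μ : ℝ} (hμ0 : 0 < μ)
    (hμ : (-generator a b p₁ p₂ N).HasEigenvalue μ) : a / 2 ≤ μ := by
  have hN' : (0 : ℝ) < (N : ℝ) - 1 := by
    have : (2 : ℝ) ≤ N := by exact_mod_cast hN
    linarith
  have hpos : ∀ n < N, (0 : ℝ) < (N : ℝ) - n := fun n hn ↦ by
    have : (n : ℝ) < N := by exact_mod_cast hn
    linarith
  refine le_of_hasEigenvalue ha hb hp₁ hp₂ (by omega) (w := fun n ↦ 1 / ((N : ℝ) - n))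
    (fun n hn ↦ one_div_pos.2 (hpos n hn)) (fun n hn ↦ ?_) hμ0 hμ
  have hn' := hpos n hn
  have hpN : p₁ / ((N : ℝ) - 1) ≤ a / 2 := by rw [div_le_iff₀ hN']; linarith
  have hN0 := hN'.ne'
  -- equality, except for `n = N - 1`, where the left side vanishes
  have hup : birthRate b p₂ N (n + 1) * (1 / ((N : ℝ) - (n + 1 : ℕ)))
      ≤ b + p₂ * (((n : ℝ) + 1) / ((N : ℝ) - 1)) := by
    rcases Nat.lt_or_ge (n + 1) N with h | h
    · have h0 := (hpos _ h).ne'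
      rw [birthRate]
      push_cast at h0 ⊢
      exact le_of_eq (by field_simp)
    · rw [show n + 1 = N by omega, birthRate_self, zero_mul]
      positivity
  have hdown : deathRate a p₁ N n * (1 / ((N : ℝ) - (n - 1 : ℕ)))
      = deathRate a p₁ N n * (1 / ((N : ℝ) - n + 1)) := by
    rcases Nat.eq_zero_or_pos n with rfl | h
    · simp
    · rw [Nat.cast_sub h, Nat.cast_one]
      congr 2
      ring
  have hid : (deathRate a p₁ N (n + 1) + birthRate b p₂ N n) * (1 / ((N : ℝ) - n))
      - (b + p₂ * (((n : ℝ) + 1) / ((N : ℝ) - 1)))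
      - deathRate a p₁ N n * (1 / ((N : ℝ) - n + 1))
      = (((N : ℝ) + 1) / ((N : ℝ) - n + 1) * (a - p₁ / ((N : ℝ) - 1))
        + (p₁ - p₂) * (((N : ℝ) - n) / ((N : ℝ) - 1))) * (1 / ((N : ℝ) - n)) := by
    have h1 := hn'.ne'
    have h2 : (N : ℝ) - n + 1 ≠ 0 := by positivity
    simp only [deathRate, birthRate, Nat.cast_add, Nat.cast_one]
    field_simp
    ring
  have hfac : a / 2 ≤ ((N : ℝ) + 1) / ((N : ℝ) - n + 1) * (a - p₁ / ((N : ℝ) - 1))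
        + (p₁ - p₂) * (((N : ℝ) - n) / ((N : ℝ) - 1)) := by
    have h1 : 1 ≤ ((N : ℝ) + 1) / ((N : ℝ) - n + 1) := by
      have : (0 : ℝ) ≤ n := n.cast_nonneg
      rw [le_div_iff₀ (by positivity)]; linarith
    have h2 : 0 ≤ (p₁ - p₂) * (((N : ℝ) - n) / ((N : ℝ) - 1)) :=
      mul_nonneg (by linarith) (by positivity)
    have h3 := mul_le_mul_of_nonneg_right h1 (show 0 ≤ a - p₁ / ((N : ℝ) - 1) by linarith)
    linarith
  have := mul_le_mul_of_nonneg_right hfac (one_div_pos.2 hn').le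
  rw [hdown]
  linarith

/-! ### Reversibility and existence of a positive eigenvalue -/

/-- The reversible measure of the birth-death chain, normalised to have mass `1` at `0`. -/
noncomputable def reversibleWeight (a b p₁ p₂ : ℝ) (N n : ℕ) : ℝ :=
  ∏ k ∈ Finset.range n, birthRate b p₂ N k / deathRate a p₁ N (k + 1)

lemma reversibleWeight_pos (ha : 0 < a) (hb : 0 < b) (hp₁ : 0 ≤ p₁) (hp₂ : 0 ≤ p₂) (hN : 1 ≤ N)
    (hn : n ≤ N) : 0 < reversibleWeight a b p₁ p₂ N n := by
  refine Finset.prod_pos fun k hk ↦ ?_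
  have hk' := Finset.mem_range.1 hk
  exact div_pos (birthRate_pos hb hp₂ hN (by omega))
    (deathRate_pos ha hp₁ hN (by omega) (by omega))

lemma detailed_balance (ha : 0 < a) (hp₁ : 0 ≤ p₁) (hN : 1 ≤ N) (hn : n < N) :
    reversibleWeight a b p₁ p₂ N (n + 1) * deathRate a p₁ N (n + 1)
      = reversibleWeight a b p₁ p₂ N n * birthRate b p₂ N n := by
  have h := (deathRate_pos ha hp₁ hN (Nat.succ_pos n) (show n + 1 ≤ N by omega)).ne'
  rw [reversibleWeight, Finset.prod_range_succ, ← reversibleWeight]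
  field_simp

lemma toMatrix'_neg_generator_apply (i j : Fin (N + 1)) :
    LinearMap.toMatrix' (-generator a b p₁ p₂ N) i j
      = -(birthRate b p₂ N i * ((if up i = j then 1 else 0) - (if i = j then 1 else 0))
        + deathRate a p₁ N i * ((if down i = j then 1 else 0) - (if i = j then 1 else 0))) := by
  simp only [LinearMap.toMatrix'_apply, LinearMap.neg_apply, Pi.neg_apply]
  change -(birthRate b p₂ N i * ((Pi.single j 1 : Fin (N + 1) → ℝ) (up i)
    - (Pi.single j 1 : Fin (N + 1) → ℝ) i) + deathRate a p₁ N i *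
    ((Pi.single j 1 : Fin (N + 1) → ℝ) (down i) - (Pi.single j 1 : Fin (N + 1) → ℝ) i)) = _
  simp only [Pi.single_apply]

lemma reversibleWeight_mul_toMatrix' (ha : 0 < a) (hp₁ : 0 ≤ p₁) (hN : 1 ≤ N)
    (i j : Fin (N + 1)) :
    reversibleWeight a b p₁ p₂ N i * LinearMap.toMatrix' (-generator a b p₁ p₂ N) i j
      = reversibleWeight a b p₁ p₂ N j * LinearMap.toMatrix' (-generator a b p₁ p₂ N) j i := by
  wlog hij : i < j generalizing i j
  · rcases (not_lt.1 hij).lt_or_eq with h | h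
    · exact (this j i h).symm
    · rw [h]
  have hv : i.val < j.val := hij
  have hj := j.isLt
  have h1 : i ≠ j := hij.ne
  have h2 : down i ≠ j := fun h ↦ by
    have := congrArg Fin.val h
    simp only [down] at this
    omega
  have h3 : up j ≠ i := fun h ↦ by
    have := congrArg Fin.val h
    simp only [up] at this
    omega
  have h4 : up i = j ↔ j.val = i.val + 1 := by
    simp only [up, Fin.ext_iff]
    omega
  have h5 : down j = i ↔ j.val = i.val + 1 := by
    simp only [down, Fin.ext_iff]
    omega
  simp only [toMatrix'_neg_generator_apply, if_neg h1, if_neg h1.symm, if_neg h2, if_neg h3, h4, h5]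
  split_ifs with h
  · have := detailed_balance (b := b) (p₂ := p₂) ha hp₁ hN (show i.val < N by omega)
    rw [h]
    linear_combination this
  · simp

lemma trace_toMatrix'_neg_generator_pos (hb : 0 < b) (ha : 0 ≤ a) (hp₁ : 0 ≤ p₁) (hp₂ : 0 ≤ p₂)
    (hN : 1 ≤ N) : 0 < (LinearMap.toMatrix' (-generator a b p₁ p₂ N)).trace := by
  refine Finset.sum_pos' (fun i _ ↦ ?_) ⟨0, Finset.mem_univ _, ?_⟩
  · have h1 := birthRate_nonneg hb.le hp₂ hN (Nat.lt_succ_iff.1 i.isLt)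
    have h2 := deathRate_nonneg ha hp₁ hN (Nat.lt_succ_iff.1 i.isLt)
    rw [Matrix.diag_apply, toMatrix'_neg_generator_apply]
    split_ifs <;> simp_all; linarith
  · have h1 := birthRate_pos (n := 0) hb hp₂ hN (by omega)
    have h2 : up (0 : Fin (N + 1)) ≠ 0 := fun h ↦ by
      have := congrArg Fin.val h
      simp [up] at this
      omega
    rw [Matrix.diag_apply, toMatrix'_neg_generator_apply, if_neg h2]
    simpa using h1

/-- The conjugate of the matrix of `-𝓖` by the square root of the reversible measure is symmetric
with the same positive trace, so one of its eigenvalues is positive. -/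
lemma exists_pos_hasEigenvalue (ha : 0 < a) (hb : 0 < b) (hp₁ : 0 ≤ p₁) (hp₂ : 0 ≤ p₂)
    (hN : 1 ≤ N) : ∃ μ : ℝ, 0 < μ ∧ (-generator a b p₁ p₂ N).HasEigenvalue μ := by
  set A := LinearMap.toMatrix' (-generator a b p₁ p₂ N) with hA
  set s : Fin (N + 1) → ℝ := fun i ↦ √(reversibleWeight a b p₁ p₂ N i) with hs
  have hpos : ∀ i : Fin (N + 1), 0 < reversibleWeight a b p₁ p₂ N i := fun i ↦
    reversibleWeight_pos ha hb hp₁ hp₂ hN (Nat.lt_succ_iff.1 i.isLt)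
  have hs0 : ∀ i, s i ≠ 0 := fun i ↦ (Real.sqrt_pos.2 (hpos i)).ne'
  have hsq : ∀ i, s i * s i = reversibleWeight a b p₁ p₂ N i := fun i ↦
    Real.mul_self_sqrt (hpos i).le
  set S : Matrix (Fin (N + 1)) (Fin (N + 1)) ℝ := Matrix.of fun i j ↦ s i * A i j / s j with hS
  have hSH : S.IsHermitian := by
    refine Matrix.IsHermitian.ext fun i j ↦ ?_
    have h := reversibleWeight_mul_toMatrix' (b := b) (p₂ := p₂) ha hp₁ hN i j
    rw [← hsq i, ← hsq j] at h
    have hi := hs0 i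
    have hj := hs0 j
    simp only [hS, Matrix.of_apply, star_trivial]
    rw [div_eq_div_iff hi hj]
    linear_combination -h
  have htr : 0 < ∑ i, hSH.eigenvalues i := by
    have h1 : S.trace = ∑ i, hSH.eigenvalues i := by
      simpa using hSH.trace_eq_sum_eigenvalues
    have h2 : S.trace = A.trace := by
      refine Finset.sum_congr rfl fun i _ ↦ ?_
      have hi := hs0 i
      simp only [hS, Matrix.diag_apply, Matrix.of_apply]
      field_simp
    rw [← h1, h2]
    exact trace_toMatrix'_neg_generator_pos hb ha.le hp₁ hp₂ hN
  obtain ⟨k, -, hk⟩ := Finset.exists_lt_of_sum_lt (s := Finset.univ) (f := fun _ ↦ (0 : ℝ))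
    (by simpa using htr)
  refine ⟨hSH.eigenvalues k, hk, ?_⟩
  set v : Fin (N + 1) → ℝ := ⇑(hSH.eigenvectorBasis k) with hv
  have hSv : S.mulVec v = hSH.eigenvalues k • v := hSH.mulVec_eigenvectorBasis k
  have hv0 : v ≠ 0 := fun h ↦ (hSH.eigenvectorBasis.orthonormal.ne_zero k) (by
    ext i
    exact congrFun h i)
  refine Module.End.hasEigenvalue_of_hasEigenvector (x := fun i ↦ v i / s i) ⟨?_, ?_⟩
  · rw [Module.End.mem_eigenspace_iff, ← LinearMap.toMatrix'_mulVec]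
    funext i
    have h := congrFun hSv i
    have hi := hs0 i
    simp only [Matrix.mulVec, dotProduct, Pi.smul_apply, smul_eq_mul, hS, Matrix.of_apply] at h ⊢
    have h' : s i * ∑ j, A i j * (v j / s j) = hSH.eigenvalues k * v i := by
      rw [← h, Finset.mul_sum]
      exact Finset.sum_congr rfl fun j _ ↦ by ring
    rw [← hA, ← mul_div_assoc, eq_div_iff hi]
    linear_combination h'
  · intro h
    apply hv0
    funext i
    have := congrFun h i
    simpa [hs0 i] using this

/-! ### The spectral gap -/

lemma spectralGap_mem (ha : 0 < a) (hb : 0 < b) (hp₁ : 0 ≤ p₁) (hp₂ : 0 ≤ p₂) (hN : 1 ≤ N) :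
    0 < spectralGap a b p₁ p₂ N ∧
      (-generator a b p₁ p₂ N).HasEigenvalue (spectralGap a b p₁ p₂ N) :=
  Set.Nonempty.csInf_mem (s := {μ : ℝ | 0 < μ ∧ (-generator a b p₁ p₂ N).HasEigenvalue μ})
    (exists_pos_hasEigenvalue ha hb hp₁ hp₂ hN)
    ((Module.End.finite_hasEigenvalue _).subset fun _ h ↦ h.2)

/-- A uniform bound for all `N` beyond a threshold that depends on the rates only. -/
lemma exists_forall_ge_le_spectralGap (ha : 0 < a) (hb : 0 < b) (hp₁ : 0 ≤ p₁) (hp₂ : 0 ≤ p₂) :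
    ∃ c : ℝ, 0 < c ∧ ∃ N₀ : ℕ, ∀ N ≥ N₀, c ≤ spectralGap a b p₁ p₂ N := by
  have hlarge : ∀ {q x : ℝ} {N : ℕ}, 0 < x → ⌈2 * q / x⌉₊ + 2 ≤ N → 2 * q ≤ x * ((N : ℝ) - 1) := by
    intro q x N hx hN
    have h1 : ((⌈2 * q / x⌉₊ + 2 : ℕ) : ℝ) ≤ N := by exact_mod_cast hN
    push_cast at h1
    have h2 := Nat.le_ceil (2 * q / x)
    rw [← div_le_iff₀' hx]
    linarith
  rcases le_total p₁ p₂ with h | h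
  · refine ⟨b / 2, half_pos hb, ⌈2 * p₂ / b⌉₊ + 2, fun N hN ↦ ?_⟩
    have hg := spectralGap_mem ha hb hp₁ hp₂ (show 1 ≤ N by omega)
    exact half_le_of_hasEigenvalue_of_le ha.le hb.le hp₁ hp₂ h (by omega) (hlarge hb hN) hg.1 hg.2
  · refine ⟨a / 2, half_pos ha, ⌈2 * p₁ / a⌉₊ + 2, fun N hN ↦ ?_⟩
    have hg := spectralGap_mem ha hb hp₁ hp₂ (show 1 ≤ N by omega)
    exact half_le_of_hasEigenvalue_of_ge ha.le hb.le hp₁ hp₂ h (by omega) (hlarge ha hN) hg.1 hg.2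

/-- A sequence that is positive from `1` on and eventually bounded below by a positive constant is
bounded below by a positive constant from `1` on. -/
lemma exists_pos_forall_lt {g : ℕ → ℝ} (hg : ∀ N, 1 ≤ N → 0 < g N) {c : ℝ} (hc : 0 < c) {N₀ : ℕ}
    (h : ∀ N ≥ N₀, c ≤ g N) : ∃ c' : ℝ, 0 < c' ∧ ∀ N, 1 ≤ N → c' < g N := by
  obtain ⟨m, hm, hmin⟩ := (Finset.Icc 1 (N₀ + 1)).exists_min_image g ⟨1, by simp⟩
  have hgm := hg m (Finset.mem_Icc.1 hm).1
  refine ⟨min c (g m) / 2, half_pos (lt_min hc hgm), fun N hN ↦ ?_⟩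
  refine (half_lt_self (lt_min hc hgm)).trans_le ?_
  rcases le_total N₀ N with hle | hle
  · exact (min_le_left _ _).trans (h N hle)
  · exact (min_le_right _ _).trans (hmin N (Finset.mem_Icc.2 ⟨hN, by omega⟩))

end FlemingViotTwoPoint

theorem mainTheorem7 (a b p₁ p₂ : ℝ) (ha : 0 < a) (hb : 0 < b) (hp₁ : 0 ≤ p₁) (hp₂ : 0 ≤ p₂)
    (hp : 0 < p₁ + p₂) (hrho : FlemingViotTwoPoint.rho a b p₁ p₂ ≤ 0) :
    ∃ c : ℝ, 0 < c ∧ ∀ N : ℕ, 1 ≤ N → c < FlemingViotTwoPoint.spectralGap a b p₁ p₂ N := by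
  obtain ⟨c, hc, N₀, h⟩ :=
    FlemingViotTwoPoint.exists_forall_ge_le_spectralGap ha hb hp₁ hp₂
  exact FlemingViotTwoPoint.exists_pos_forall_lt
    (fun N hN ↦ (FlemingViotTwoPoint.spectralGap_mem ha hb hp₁ hp₂ hN).1) hc h
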